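/- Corollary 4.6 (Stanley's reciprocity theorem). Let $A$ be an $r\times n$ matrix with integer entries and of rank $r$, and suppose that there is a vector $\alpha\in\mathbb{P}^n$ with $A\alpha=\mathbf{0}$, where $\mathbb{P}$ denotes the set of positive integers. Let $$K=P(A,\mathbf{0})=\{\alpha\in\mathbb{R}_{\ge 0}^n : A\alpha=\mathbf{0}\},$$ and define the formal power series $$\sigma_K(\mathbf{y})=\sum_{\alpha\in K\cap\mathbb{Z}^n}\mathbf{y}^\alpha,\qquad \bar\sigma_K(\mathbf{y})=\sum_{\alpha\in K\cap\mathbb{P}^n}\mathbf{y}^\alpha,\qquad \mathbf{y}^\alpha=y_1^{\alpha_1}\cdots y_n^{\alpha_n}.$$ Then $\sigma_K(\mathbf{y})$ and $\bar\sigma_K(\mathbf{y})$ are the power series expansions of (unique) rational functions in $\mathbb{C}(y_1,\dots,y_n)$, and, writing $\sigma_K$ and $\bar\sigma_K$ also for these rational functions, $$\sigma_K(\mathbf{y})=(-1)^{n-r}\,\bar\sigma_K(\mathbf{y}^{-1})$$ as rational functions, where $\mathbf{y}^{-1}=(y_1^{-1},\dots,y_n^{-1})$. -/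

import Mathlib

/-- The polyhedron `P(A, b) = {α ∈ ℝ_{≥0}^n : A α = b}` of an integral matrix `A` and an integral
vector `b`. -/
def polyhedron {r n : ℕ} (A : Matrix (Fin r) (Fin n) ℤ) (b : Fin r → ℤ) : Set (Fin n → ℝ) :=
  {α | (∀ i, 0 ≤ α i) ∧ (A.map (fun a : ℤ => (a : ℝ))).mulVec α = fun i => (b i : ℝ)}

/-- `ℙ^n`, the vectors all of whose entries are positive integers, as a subset of `ℝ^n`. -/
def positivePoints (n : ℕ) : Set (Fin n → ℝ) :=
  {α | ∀ i, ∃ k : ℕ, 0 < k ∧ α i = k}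

open scoped Classical in
/-- The lattice point generating function `σ_S(y) = ∑_{α ∈ S ∩ ℤ^n} y^α` of a subset `S` of the
nonnegative orthant, as a formal power series: the coefficient of `y^m` is `1` if `m ∈ S` and `0`
otherwise. -/
noncomputable def latticeGenFun {n : ℕ} (S : Set (Fin n → ℝ)) : MvPowerSeries (Fin n) ℂ :=
  fun m => if (fun i => (m i : ℝ)) ∈ S then 1 else 0

/-- The field `ℂ(y_1, …, y_n)` of rational functions. -/
abbrev RatFunField (n : ℕ) : Type := FractionRing (MvPolynomial (Fin n) ℂ)

/-- `f` is the power series expansion of the rational function `R`: for some polynomials `p` and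
`q ≠ 0` one has `R = p / q` and `q * f = p` in the ring of power series. -/
def IsExpansionOf {n : ℕ} (f : MvPowerSeries (Fin n) ℂ) (R : RatFunField n) : Prop :=
  ∃ p q : MvPolynomial (Fin n) ℂ, q ≠ 0 ∧
    R = algebraMap (MvPolynomial (Fin n) ℂ) (RatFunField n) p /
      algebraMap (MvPolynomial (Fin n) ℂ) (RatFunField n) q ∧
    (q : MvPowerSeries (Fin n) ℂ) * f = (p : MvPowerSeries (Fin n) ℂ)

/-- A power series is the expansion of at most one rational function. -/
theorem IsExpansionOf.unique {n : ℕ} {f : MvPowerSeries (Fin n) ℂ} {R R' : RatFunField n}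
    (h : IsExpansionOf f R) (h' : IsExpansionOf f R') : R = R' := by
  obtain ⟨p, q, hq, rfl, hf⟩ := h
  obtain ⟨p', q', hq', rfl, hf'⟩ := h'
  have inj := IsFractionRing.injective (MvPolynomial (Fin n) ℂ) (RatFunField n)
  have e : p * q' = p' * q := by
    apply MvPolynomial.coe_injective
    rw [MvPolynomial.coe_mul, MvPolynomial.coe_mul, ← hf, ← hf']
    ring
  rw [div_eq_div_iff ((map_ne_zero_iff _ inj).2 hq) ((map_ne_zero_iff _ inj).2 hq'),
    ← map_mul, ← map_mul, e]

/-- Substitution of `y_i⁻¹` for `y_i` in a polynomial. -/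
noncomputable def invVarsPoly (n : ℕ) : MvPolynomial (Fin n) ℂ →+* RatFunField n :=
  (MvPolynomial.aeval (R := ℂ) fun i =>
    (algebraMap (MvPolynomial (Fin n) ℂ) (RatFunField n) (MvPolynomial.X i))⁻¹).toRingHom

theorem invVarsPoly_injective (n : ℕ) : Function.Injective (invVarsPoly n) := by
  classical
  rw [injective_iff_map_eq_zero]
  intro p hp
  have inj := IsFractionRing.injective (MvPolynomial (Fin n) ℂ) (RatFunField n)
  set ι := algebraMap (MvPolynomial (Fin n) ℂ) (RatFunField n) with hι
  let N : Fin n →₀ ℕ := Finsupp.equivFunOnFinite.symm fun i => MvPolynomial.degreeOf i p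
  have hle : ∀ m ∈ p.support, m ≤ N := fun m hm i => MvPolynomial.monomial_le_degreeOf i hm
  have hX : ∀ i : Fin n, ι (MvPolynomial.X i) ≠ 0 := fun i =>
    (map_ne_zero_iff _ inj).2 (MvPolynomial.X_ne_zero i)
  have key : ∑ m ∈ p.support, MvPolynomial.monomial (N - m) (p.coeff m) = 0 := by
    apply inj
    have h1 : invVarsPoly n p = ∑ m ∈ p.support,
        ι (MvPolynomial.C (p.coeff m)) * ∏ i, (ι (MvPolynomial.X i))⁻¹ ^ m i := by
      change MvPolynomial.aeval _ p = _
      rw [MvPolynomial.aeval_def, MvPolynomial.eval₂_eq']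
      rfl
    have h2 : (∏ i, ι (MvPolynomial.X i) ^ N i) * invVarsPoly n p =
        ι (∑ m ∈ p.support, MvPolynomial.monomial (N - m) (p.coeff m)) := by
      rw [h1, Finset.mul_sum, map_sum]
      refine Finset.sum_congr rfl fun m hm => ?_
      rw [MvPolynomial.monomial_eq, Finsupp.prod_fintype _ _ (fun i => pow_zero _), map_mul,
        map_prod, mul_left_comm, ← Finset.prod_mul_distrib]
      congr 1
      refine Finset.prod_congr rfl fun i _ => ?_
      rw [map_pow, Finsupp.tsub_apply, pow_sub₀ _ (hX i) (hle m hm i), inv_pow]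
    rw [← h2, hp, mul_zero, map_zero]
  ext m
  by_contra hm
  have hm' : m ∈ p.support := MvPolynomial.mem_support_iff.2 (by simpa using hm)
  have := congrArg (MvPolynomial.coeff (N - m)) key
  rw [MvPolynomial.coeff_sum, Finset.sum_eq_single m] at this
  · rw [MvPolynomial.coeff_monomial, if_pos rfl] at this
    exact hm (by simpa using this)
  · intro m' hm1 hne
    rw [MvPolynomial.coeff_monomial, if_neg]
    intro h
    apply hne
    rw [← tsub_tsub_cancel_of_le (hle m' hm1), h, tsub_tsub_cancel_of_le (hle m hm')]
  · exact fun h => absurd hm' h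

/-- The substitution `R(y) ↦ R(y⁻¹)`, that is `y_i ↦ y_i⁻¹` for all `i`, on rational functions. -/
noncomputable def invVars (n : ℕ) : RatFunField n →+* RatFunField n :=
  IsFractionRing.lift (invVarsPoly_injective n)

/-!
Solutions of `A α = 0` in nonnegative integers are cut out of the lattice `ker A` by the `n`
coordinate functionals, so reciprocity is a statement about a lattice `Λ`, viewed as the dual of a
finitely generated group `Γ`, and about cones in `Λ` given by vectors `w i ∈ Γ`. It is proved for
half-open cones. Fix a total order on `Γ`, and let the facet `φ (w i) = 0` be excluded from the cone
if `w i < 0`, included if `w i > 0`. Substituting `y⁻¹` then exchanges, up to the sign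
`(-1) ^ rank Λ`, this cone and the one with the opposite choice (`reciprocal_halfOpenCone`). When
the order makes all coordinates positive, the two cones are `K` and its interior.

The order makes subdivisions disjoint. Cutting a cone along `w a = w b` replaces the pair
`(w a, w b)` by `(w a - w b, w b)` on one side and by `(w a, w b - w a)` on the other. These two
vectors are negatives of each other, so exactly one of the two pieces contains the wall
(`halfOpenCone_eq_union`, `disjoint_halfOpenCone_update`), and no lower-dimensional correction terms
occur. The embedding of `Λ` in `ℤ^n` stays of the form `φ ↦ ∑ φ (w i) v_i` with `v_i ∈ ℕ^n`, so that
all series remain ordinary power series.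

Such cuts, in the order of Elliott's algorithm, shrink a linear relation between the `w i` until
either its coefficients have the same sign, when both cones are empty
(`halfOpenCone_eq_empty`), or two of the `w i` agree and one of them can be dropped
(`reciprocal_of_relation`). What is left are the cones for which the `w i` form a basis of `Γ`.
Their generating functions are products of factors `1 / (1 - y^v)` and `y^v / (1 - y^v)`, which
`y ↦ y⁻¹` exchanges up to sign (`reciprocal_of_linearIndepOn`).

A suitable `Γ` is the group generated by the coordinates of a family `u 0, …, u m` of generators of
`ker A`, ordered lexicographically, with `u 0` the given positive solution.
-/

/-! ### Expansions of rational functions and the substitution `y ↦ y⁻¹` -/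

open MvPolynomial in
theorem invVars_algebraMap_monomial {n : ℕ} (v : Fin n →₀ ℕ) :
    invVars n (algebraMap (MvPolynomial (Fin n) ℂ) (RatFunField n) (monomial v 1)) =
      (algebraMap (MvPolynomial (Fin n) ℂ) (RatFunField n) (monomial v 1))⁻¹ := by
  rw [invVars, IsFractionRing.lift_algebraMap]
  change MvPolynomial.aeval _ _ = _
  rw [aeval_monomial, map_one, one_mul, monomial_eq, map_one, one_mul,
    Finsupp.prod_fintype _ _ (fun i => pow_zero _), Finsupp.prod_fintype _ _ (fun i => pow_zero _),
    map_prod, ← Finset.prod_inv_distrib]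
  simp only [map_pow, inv_pow]

namespace IsExpansionOf

variable {n : ℕ} {f g : MvPowerSeries (Fin n) ℂ} {R S : RatFunField n}

theorem zero : IsExpansionOf (0 : MvPowerSeries (Fin n) ℂ) 0 :=
  ⟨0, 1, one_ne_zero, by simp, by simp⟩

theorem one : IsExpansionOf (1 : MvPowerSeries (Fin n) ℂ) 1 :=
  ⟨1, 1, one_ne_zero, by simp, by simp⟩

theorem add (hf : IsExpansionOf f R) (hg : IsExpansionOf g S) : IsExpansionOf (f + g) (R + S) := by
  obtain ⟨p, q, hq, rfl, hf⟩ := hf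
  obtain ⟨p', q', hq', rfl, hg⟩ := hg
  have inj := IsFractionRing.injective (MvPolynomial (Fin n) ℂ) (RatFunField n)
  refine ⟨p * q' + q * p', q * q', mul_ne_zero hq hq', ?_, ?_⟩
  · rw [div_add_div _ _ ((map_ne_zero_iff _ inj).2 hq) ((map_ne_zero_iff _ inj).2 hq')]
    simp only [map_mul, map_add]
  · simp only [MvPolynomial.coe_mul, MvPolynomial.coe_add, ← hf, ← hg]
    ring

theorem polynomial_mul (hf : IsExpansionOf f R) (a : MvPolynomial (Fin n) ℂ) :
    IsExpansionOf ((a : MvPowerSeries (Fin n) ℂ) * f)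
      (algebraMap (MvPolynomial (Fin n) ℂ) (RatFunField n) a * R) := by
  obtain ⟨p, q, hq, rfl, hf⟩ := hf
  refine ⟨a * p, q, hq, by rw [map_mul, mul_div_assoc], ?_⟩
  rw [MvPolynomial.coe_mul, ← hf]
  ring

theorem of_polynomial_mul {a : MvPolynomial (Fin n) ℂ} (ha : a ≠ 0)
    (hf : IsExpansionOf ((a : MvPowerSeries (Fin n) ℂ) * f) R) :
    IsExpansionOf f (R / algebraMap (MvPolynomial (Fin n) ℂ) (RatFunField n) a) := by
  obtain ⟨p, q, hq, rfl, hf⟩ := hf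
  refine ⟨p, q * a, mul_ne_zero hq ha, by rw [map_mul, div_div], ?_⟩
  rw [MvPolynomial.coe_mul, ← hf, mul_assoc]

end IsExpansionOf

/-- The power series `f` and `g` are expansions of rational functions `R` and `S` with
`R(y) = (-1)^d S(y⁻¹)`. -/
def Reciprocal {n : ℕ} (f g : MvPowerSeries (Fin n) ℂ) (d : ℕ) : Prop :=
  ∃ R S : RatFunField n, IsExpansionOf f R ∧ IsExpansionOf g S ∧ R = (-1) ^ d * invVars n S

namespace Reciprocal

open MvPolynomial

variable {n d : ℕ} {f g f' g' : MvPowerSeries (Fin n) ℂ}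

theorem zero : Reciprocal (0 : MvPowerSeries (Fin n) ℂ) 0 d :=
  ⟨0, 0, .zero, .zero, by simp⟩

theorem one : Reciprocal (1 : MvPowerSeries (Fin n) ℂ) 1 0 :=
  ⟨1, 1, .one, .one, by simp⟩

theorem add (h : Reciprocal f g d) (h' : Reciprocal f' g' d) :
    Reciprocal (f + f') (g + g') d := by
  obtain ⟨R, S, hR, hS, e⟩ := h
  obtain ⟨R', S', hR', hS', e'⟩ := h'
  exact ⟨R + R', S + S', hR.add hR', hS.add hS', by rw [e, e', map_add, mul_add]⟩

theorem one_sub_monomial_ne_zero {v : Fin n →₀ ℕ} (hv : v ≠ 0) :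
    (1 - monomial v 1 : MvPolynomial (Fin n) ℂ) ≠ 0 := by
  classical
  intro h
  have := congrArg (coeff 0) h
  rw [coeff_sub, coeff_monomial, if_neg hv, coeff_zero_one] at this
  simp at this

/-- Adjoining a generator `v` on the closed side of the first cone, hence on the open side of the
second: `1 / (1 - y^v)` and `y^v / (1 - y^v)` are exchanged, up to sign, by `y ↦ y⁻¹`. -/
theorem of_one_sub_mul_left {v : Fin n →₀ ℕ} (hv : v ≠ 0) (h : Reciprocal f g d)
    (hf : ((1 - monomial v 1 : MvPolynomial (Fin n) ℂ) : MvPowerSeries (Fin n) ℂ) * f' = f)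
    (hg : ((1 - monomial v 1 : MvPolynomial (Fin n) ℂ) : MvPowerSeries (Fin n) ℂ) * g' =
      ((monomial v 1 : MvPolynomial (Fin n) ℂ) : MvPowerSeries (Fin n) ℂ) * g) :
    Reciprocal f' g' (d + 1) := by
  obtain ⟨R, S, hR, hS, e⟩ := h
  have inj := IsFractionRing.injective (MvPolynomial (Fin n) ℂ) (RatFunField n)
  have h1 := one_sub_monomial_ne_zero hv
  refine ⟨_, _, .of_polynomial_mul h1 (hf ▸ hR), .of_polynomial_mul h1 (hg ▸ hS.polynomial_mul _),
    ?_⟩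
  have h2 := (map_ne_zero_iff _ inj).2 h1
  have h3 : algebraMap (MvPolynomial (Fin n) ℂ) (RatFunField n) (monomial v 1) ≠ 0 :=
    (map_ne_zero_iff _ inj).2 (by simp)
  rw [map_div₀, map_mul, map_sub, map_sub, map_one (algebraMap _ _),
    map_one (invVars n), invVars_algebraMap_monomial, e]
  rw [map_sub, map_one] at h2
  generalize algebraMap (MvPolynomial (Fin n) ℂ) (RatFunField n) (monomial v 1) = t at *
  have h4 : t - 1 ≠ 0 := by rwa [← neg_sub, neg_ne_zero]
  have h5 : 1 - t⁻¹ = (t - 1) / t := by field_simp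
  rw [h5, pow_succ]
  generalize invVars n S = z
  field_simp
  ring

/-- Adjoining a generator `v` on the open side of the first cone, hence on the closed side of the
second. -/
theorem of_one_sub_mul_right {v : Fin n →₀ ℕ} (hv : v ≠ 0) (h : Reciprocal f g d)
    (hf : ((1 - monomial v 1 : MvPolynomial (Fin n) ℂ) : MvPowerSeries (Fin n) ℂ) * f' =
      ((monomial v 1 : MvPolynomial (Fin n) ℂ) : MvPowerSeries (Fin n) ℂ) * f)
    (hg : ((1 - monomial v 1 : MvPolynomial (Fin n) ℂ) : MvPowerSeries (Fin n) ℂ) * g' = g) :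
    Reciprocal f' g' (d + 1) := by
  obtain ⟨R, S, hR, hS, e⟩ := h
  have inj := IsFractionRing.injective (MvPolynomial (Fin n) ℂ) (RatFunField n)
  have h1 := one_sub_monomial_ne_zero hv
  refine ⟨_, _, .of_polynomial_mul h1 (hf ▸ hR.polynomial_mul _), .of_polynomial_mul h1 (hg ▸ hS),
    ?_⟩
  have h2 := (map_ne_zero_iff _ inj).2 h1
  have h3 : algebraMap (MvPolynomial (Fin n) ℂ) (RatFunField n) (monomial v 1) ≠ 0 :=
    (map_ne_zero_iff _ inj).2 (by simp)
  rw [map_div₀, map_sub, map_sub, map_one (algebraMap _ _),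
    map_one (invVars n), invVars_algebraMap_monomial, e]
  rw [map_sub, map_one] at h2
  generalize algebraMap (MvPolynomial (Fin n) ℂ) (RatFunField n) (monomial v 1) = t at *
  have h4 : t - 1 ≠ 0 := by rwa [← neg_sub, neg_ne_zero]
  have h5 : 1 - t⁻¹ = (t - 1) / t := by field_simp
  rw [h5, pow_succ]
  generalize invVars n S = z
  field_simp
  ring

end Reciprocal

/-! ### Generating functions of half-open cones -/

section GeneratingFunction

variable {n : ℕ} {Λ : Type*} [AddCommGroup Λ]

open scoped Classical in
/-- The generating function `∑_{φ ∈ C} y^{μ(φ)}` of a subset `C` of a lattice `Λ` embedded by `μ`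
into `ℤ^n`; points of `C` with image outside `ℕ^n` are ignored. -/
noncomputable def genFun (μ : Λ →+ (Fin n → ℤ)) (C : Set Λ) : MvPowerSeries (Fin n) ℂ :=
  fun m => if ∃ φ ∈ C, ∀ j, μ φ j = m j then 1 else 0

variable {μ : Λ →+ (Fin n → ℤ)}

open scoped Classical in
theorem coeff_genFun (C : Set Λ) (m : Fin n →₀ ℕ) :
    MvPowerSeries.coeff m (genFun μ C) = if ∃ φ ∈ C, ∀ j, μ φ j = m j then 1 else 0 :=
  rfl

theorem genFun_empty : genFun μ ∅ = 0 := by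
  ext m
  simp [coeff_genFun]

theorem genFun_union (hμ : Function.Injective μ) {C D : Set Λ} (h : Disjoint C D) :
    genFun μ (C ∪ D) = genFun μ C + genFun μ D := by
  classical
  ext m
  rw [map_add, coeff_genFun, coeff_genFun, coeff_genFun]
  by_cases hC : ∃ φ ∈ C, ∀ j, μ φ j = m j
  · have hD : ¬ ∃ φ ∈ D, ∀ j, μ φ j = m j := by
      rintro ⟨ψ, hψ, e⟩
      obtain ⟨φ, hφ, e'⟩ := hC
      have : φ = ψ := hμ (funext fun j => (e' j).trans (e j).symm)
      exact Set.disjoint_left.1 h hφ (this ▸ hψ)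
    rw [if_pos hC, if_neg hD, if_pos, add_zero]
    obtain ⟨φ, hφ, e⟩ := hC
    exact ⟨φ, Or.inl hφ, e⟩
  · rw [if_neg hC, zero_add]
    refine if_congr ⟨?_, ?_⟩ rfl rfl
    · rintro ⟨φ, hφ | hφ, e⟩
      · exact absurd ⟨φ, hφ, e⟩ hC
      · exact ⟨φ, hφ, e⟩
    · rintro ⟨φ, hφ, e⟩
      exact ⟨φ, Or.inr hφ, e⟩

theorem genFun_singleton_zero : genFun μ {0} = 1 := by
  classical
  ext m
  rw [coeff_genFun, MvPowerSeries.coeff_one]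
  refine if_congr ?_ rfl rfl
  simp only [Set.mem_singleton_iff, exists_eq_left, map_zero, Pi.zero_apply]
  constructor
  · intro h
    ext j
    have := h j
    simp only [Finsupp.coe_zero, Pi.zero_apply]
    omega
  · rintro rfl j
    simp

theorem genFun_translate {C : Set Λ} (hC : ∀ φ ∈ C, ∀ j, 0 ≤ μ φ j) {e : Λ} {v : Fin n →₀ ℕ}
    (he : ∀ j, μ e j = v j) :
    genFun μ ((fun φ => φ + e) '' C) =
      ((MvPolynomial.monomial v 1 : MvPolynomial (Fin n) ℂ) : MvPowerSeries (Fin n) ℂ) *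
        genFun μ C := by
  classical
  ext m
  rw [MvPolynomial.coe_monomial, MvPowerSeries.coeff_monomial_mul, coeff_genFun, coeff_genFun]
  simp only [Set.exists_mem_image, map_add, Pi.add_apply, he, one_mul]
  by_cases hvm : v ≤ m
  · rw [if_pos hvm]
    refine if_congr (exists_congr fun φ => and_congr_right fun _ => forall_congr' fun j => ?_) rfl
      rfl
    have := hvm j
    rw [Finsupp.tsub_apply]
    omega
  · rw [if_neg hvm, if_neg]
    rintro ⟨φ, hφ, e⟩
    refine hvm fun j => ?_
    have := e j
    have := hC φ hφ j
    omega

end GeneratingFunction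

section Cones

variable {Γ : Type*} [AddCommGroup Γ] {ι : Type*}

/-- `N` is the set of negative (or that of positive) elements of some total group order on `Γ`. -/
structure IsStrictHalf (N : Γ → Prop) : Prop where
  add : ∀ {a b}, N a → N b → N (a + b)
  not_neg : ∀ {a}, N a → ¬ N (-a)
  total : ∀ {a}, a ≠ 0 → N a ∨ N (-a)

theorem IsStrictHalf.neg {N : Γ → Prop} (hN : IsStrictHalf N) :
    IsStrictHalf fun a => N (-a) where
  add ha hb := by rw [neg_add]; exact hN.add ha hb
  not_neg ha := hN.not_neg ha
  total ha := hN.total (neg_ne_zero.2 ha)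

/-- The half-open cone of all integral functionals that are nonnegative on the vectors `w i`, and
positive on those `w i` that lie in `N`. -/
def halfOpenCone (N : Γ → Prop) (s : Finset ι) (w : ι → Γ) : Set (Γ →ₗ[ℤ] ℤ) :=
  {φ | ∀ i ∈ s, 0 ≤ φ (w i) ∧ (N (w i) → 0 < φ (w i))}

/-- A nonnegative relation between the `w i` has terms `w i` on both sides of the order, one of
which lies in `N`; no functional in the cone is compatible with that. -/
theorem halfOpenCone_eq_empty {N : Γ → Prop} (hN : IsStrictHalf N) {s : Finset ι} {w : ι → Γ}
    (h0 : ∀ i ∈ s, w i ≠ 0) {c : ι → ℤ} (hc : ∑ i ∈ s, c i • w i = 0) (hpos : ∀ i ∈ s, 0 ≤ c i)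
    (hne : ∃ i ∈ s, c i ≠ 0) : halfOpenCone N s w = ∅ := by
  classical
  have key : ∃ i ∈ s, 0 < c i ∧ N (w i) := by
    by_contra! hcon
    -- otherwise the relation is a nonempty sum of elements of the opposite half
    have hsmul : ∀ (k : ℕ) (a : Γ), N (-a) → N (-((k + 1) • a)) := by
      intro k a ha
      induction k with
      | zero => simpa using ha
      | succ k ih => rw [succ_nsmul, neg_add]; exact hN.add ih ha
    have hterm : ∀ i ∈ s, c i ≠ 0 → N (-(c i • w i)) := by
      intro i hi hci
      have hlt : 0 < c i := lt_of_le_of_ne (hpos i hi) (Ne.symm hci)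
      obtain ⟨k, hk⟩ := Int.eq_succ_of_zero_lt hlt
      have h1 := hsmul k (w i) ((hN.total (h0 i hi)).resolve_left (hcon i hi hlt))
      rw [hk]
      exact_mod_cast h1
    have hsum : ∀ t ⊆ s, (∃ i ∈ t, c i ≠ 0) → N (-∑ i ∈ t, c i • w i) := by
      intro t
      induction t using Finset.induction_on with
      | empty => rintro _ ⟨i, hi, _⟩; simp at hi
      | insert a t ha ih =>
        intro hts hex
        rw [Finset.insert_subset_iff] at hts
        rw [Finset.sum_insert ha, neg_add]
        by_cases hca : c a = 0
        · rw [hca, zero_smul, neg_zero, zero_add]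
          obtain ⟨i, hi, hci⟩ := hex
          rcases Finset.mem_insert.1 hi with rfl | hi
          · exact absurd hca hci
          · exact ih hts.2 ⟨i, hi, hci⟩
        · by_cases hex' : ∃ i ∈ t, c i ≠ 0
          · exact hN.add (hterm a hts.1 hca) (ih hts.2 hex')
          · push Not at hex'
            rw [Finset.sum_eq_zero fun i hi => by rw [hex' i hi, zero_smul], neg_zero, add_zero]
            exact hterm a hts.1 hca
    have h1 := hsum s subset_rfl hne
    rw [hc] at h1
    have h2 := hN.not_neg h1
    rw [neg_neg] at h2
    rw [neg_zero] at h1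
    exact h2 h1
  obtain ⟨a, ha, hca, hNa⟩ := key
  refine Set.eq_empty_iff_forall_notMem.2 fun φ hφ => ?_
  have h1 := congrArg φ hc
  rw [map_sum, map_zero] at h1
  simp only [map_smul, smul_eq_mul] at h1
  have h2 := (Finset.sum_eq_zero_iff_of_nonneg
    fun i hi => mul_nonneg (hpos i hi) (hφ i hi).1).1 h1 a ha
  exact (mul_pos hca ((hφ a ha).2 hNa)).ne' h2

variable [DecidableEq ι] {N : Γ → Prop} {s : Finset ι} {w : ι → Γ} {a b : ι}

theorem mem_halfOpenCone_update (ha : a ∈ s) (x : Γ) (φ : Γ →ₗ[ℤ] ℤ) :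
    φ ∈ halfOpenCone N s (Function.update w a x) ↔
      (0 ≤ φ x ∧ (N x → 0 < φ x)) ∧
        ∀ i ∈ s, i ≠ a → 0 ≤ φ (w i) ∧ (N (w i) → 0 < φ (w i)) := by
  constructor
  · intro h
    refine ⟨by simpa using h a ha, fun i hi hne => ?_⟩
    have := h i hi
    rwa [Function.update_of_ne hne] at this
  · rintro ⟨h1, h2⟩ i hi
    rcases eq_or_ne i a with rfl | hne
    · simpa using h1
    · rw [Function.update_of_ne hne]
      exact h2 i hi hne

theorem halfOpenCone_update_subset (hN : IsStrictHalf N) (h0 : ∀ i ∈ s, w i ≠ 0) (ha : a ∈ s)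
    (hb : b ∈ s) (hab : a ≠ b) (hw : w a ≠ w b) :
    halfOpenCone N s (Function.update w a (w a - w b)) ⊆ halfOpenCone N s w := by
  intro φ hφ
  obtain ⟨⟨h1, h2⟩, h3⟩ := (mem_halfOpenCone_update ha _ φ).1 hφ
  rw [map_sub] at h1 h2
  obtain ⟨h4, h5⟩ := h3 b hb hab.symm
  intro i hi
  rcases eq_or_ne i a with rfl | hne
  · refine ⟨by linarith, fun hNi => ?_⟩
    rcases hN.total (sub_ne_zero.2 hw) with h | h
    · linarith [h2 h]
    · rcases hN.total (h0 b hb) with h' | h'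
      · linarith [h5 h']
      · refine absurd (hN.add h h') ?_
        rw [← neg_add, sub_add_cancel]
        exact hN.not_neg hNi
  · exact h3 i hi hne

/-- A hyperplane `w a = w b` cuts a half-open cone into two half-open cones of the same kind: the
order decides which of the two contains the points on the hyperplane. -/
theorem halfOpenCone_eq_union (hN : IsStrictHalf N) (h0 : ∀ i ∈ s, w i ≠ 0) (ha : a ∈ s)
    (hb : b ∈ s) (hab : a ≠ b) (hw : w a ≠ w b) :
    halfOpenCone N s w = halfOpenCone N s (Function.update w a (w a - w b)) ∪
      halfOpenCone N s (Function.update w b (w b - w a)) := by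
  refine Set.Subset.antisymm (fun φ hφ => ?_) (Set.union_subset
    (halfOpenCone_update_subset hN h0 ha hb hab hw)
    (halfOpenCone_update_subset hN h0 hb ha hab.symm hw.symm))
  rw [Set.mem_union, mem_halfOpenCone_update ha, mem_halfOpenCone_update hb, map_sub, map_sub]
  have hnot : N (w a - w b) → ¬ N (w b - w a) := fun h => by
    rw [← neg_sub]; exact hN.not_neg h
  rcases lt_trichotomy (φ (w a)) (φ (w b)) with h | h | h
  · exact Or.inr ⟨⟨by linarith, fun _ => by linarith⟩, fun i hi _ => hφ i hi⟩
  · by_cases hN' : N (w a - w b)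
    · exact Or.inr ⟨⟨by linarith, fun h' => absurd h' (hnot hN')⟩, fun i hi _ => hφ i hi⟩
    · exact Or.inl ⟨⟨by linarith, fun h' => absurd h' hN'⟩, fun i hi _ => hφ i hi⟩
  · exact Or.inl ⟨⟨by linarith, fun _ => by linarith⟩, fun i hi _ => hφ i hi⟩

theorem disjoint_halfOpenCone_update (hN : IsStrictHalf N) (ha : a ∈ s) (hb : b ∈ s)
    (hw : w a ≠ w b) :
    Disjoint (halfOpenCone N s (Function.update w a (w a - w b)))
      (halfOpenCone N s (Function.update w b (w b - w a))) := by
  refine Set.disjoint_left.2 fun φ hφ hφ' => ?_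
  have h1 := ((mem_halfOpenCone_update ha _ φ).1 hφ).1
  have h2 := ((mem_halfOpenCone_update hb _ φ).1 hφ').1
  rw [map_sub] at h1 h2
  rcases hN.total (sub_ne_zero.2 hw) with h | h
  · linarith [h1.2 h, h2.1]
  · rw [neg_sub] at h
    linarith [h2.2 h, h1.1]

theorem halfOpenCone_erase (ha : a ∈ s) (hb : b ∈ s) (hab : a ≠ b) (hw : w a = w b) :
    halfOpenCone N (s.erase b) w = halfOpenCone N s w := by
  refine Set.Subset.antisymm (fun φ hφ i hi => ?_) fun φ hφ i hi =>
    hφ i (Finset.mem_of_mem_erase hi)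
  rcases eq_or_ne i b with rfl | hne
  · rw [← hw]
    exact hφ a (Finset.mem_erase.2 ⟨hab, ha⟩)
  · exact hφ i (Finset.mem_erase.2 ⟨hne, hi⟩)

end Cones

/-! ### Presentations and simplicial cones -/

section Presentations

variable {Γ : Type*} [AddCommGroup Γ] {ι : Type*} {n : ℕ}

/-- The vectors `w i`, `i ∈ s`, are nonzero and generate `Γ`, and the embedding `μ` of the dual
lattice into `ℤ^n` is `φ ↦ ∑ i ∈ s, φ (w i) v_i`, where the `v_i` have nonnegative entries. -/
structure IsPresentation (μ : (Γ →ₗ[ℤ] ℤ) →+ (Fin n → ℤ)) (s : Finset ι) (w : ι → Γ)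
    (v : ι → Fin n →₀ ℕ) : Prop where
  ne_zero : ∀ i ∈ s, w i ≠ 0
  span_eq : Submodule.span ℤ (w '' s) = ⊤
  map_eq : ∀ φ j, μ φ j = ∑ i ∈ s, φ (w i) * v i j

variable {μ : (Γ →ₗ[ℤ] ℤ) →+ (Fin n → ℤ)} {s : Finset ι} {w : ι → Γ} {v : ι → Fin n →₀ ℕ}

theorem Finset.sum_eq_add_add_sum_erase_erase {M : Type*} [AddCommMonoid M] [DecidableEq ι]
    {a b : ι} (ha : a ∈ s) (hb : b ∈ s) (hab : a ≠ b) (f : ι → M) :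
    ∑ i ∈ s, f i = f a + (f b + ∑ i ∈ (s.erase a).erase b, f i) := by
  rw [Finset.add_sum_erase _ _ (Finset.mem_erase.2 ⟨hab.symm, hb⟩), Finset.add_sum_erase _ _ ha]

namespace IsPresentation

theorem map_nonneg (h : IsPresentation μ s w v) {φ : Γ →ₗ[ℤ] ℤ} (hφ : ∀ i ∈ s, 0 ≤ φ (w i))
    (j : Fin n) : 0 ≤ μ φ j := by
  rw [h.map_eq]
  exact Finset.sum_nonneg fun i hi => mul_nonneg (hφ i hi) (Int.natCast_nonneg _)

theorem map_dual (h : IsPresentation μ s w v) {a : ι} {e : Γ →ₗ[ℤ] ℤ} (ha : a ∈ s)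
    (hea : e (w a) = 1) (he : ∀ i ∈ s, i ≠ a → e (w i) = 0) (j : Fin n) : μ e j = v a j := by
  rw [h.map_eq, Finset.sum_eq_single_of_mem a ha fun i hi hne => by rw [he i hi hne, zero_mul],
    hea, one_mul]

variable [DecidableEq ι] {a b : ι}

theorem shear (h : IsPresentation μ s w v) (ha : a ∈ s) (hb : b ∈ s) (hab : a ≠ b)
    (hw : w a ≠ w b) :
    IsPresentation μ s (Function.update w a (w a - w b)) (Function.update v b (v a + v b)) where
  ne_zero i hi := by
    rcases eq_or_ne i a with rfl | hne
    · rw [Function.update_self]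
      exact sub_ne_zero.2 hw
    · rw [Function.update_of_ne hne]
      exact h.ne_zero i hi
  span_eq := by
    rw [eq_top_iff, ← h.span_eq, Submodule.span_le]
    have key : ∀ i ∈ s, Function.update w a (w a - w b) i ∈
        Submodule.span ℤ (Function.update w a (w a - w b) '' s) := fun i hi =>
      Submodule.subset_span ⟨i, hi, rfl⟩
    rintro _ ⟨i, hi, rfl⟩
    rcases eq_or_ne i a with rfl | hne
    · have h1 := key i hi
      have h2 := key b hb
      rw [Function.update_self] at h1
      rw [Function.update_of_ne hab.symm] at h2
      simpa using add_mem h1 h2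
    · have h1 := key i hi
      rwa [Function.update_of_ne hne] at h1
  map_eq φ j := by
    rw [h.map_eq, Finset.sum_eq_add_add_sum_erase_erase ha hb hab,
      Finset.sum_eq_add_add_sum_erase_erase ha hb hab, Function.update_self,
      Function.update_of_ne hab, Function.update_self, Function.update_of_ne hab.symm]
    rw [Finset.sum_congr (s₁ := (s.erase a).erase b) rfl
      (f := fun i => φ (Function.update w a (w a - w b) i) *
        (Function.update v b (v a + v b) i j : ℤ))
      (g := fun i => φ (w i) * (v i j : ℤ)) fun i hi => by
      rw [Function.update_of_ne (Finset.ne_of_mem_erase (Finset.mem_of_mem_erase hi)),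
        Function.update_of_ne (Finset.ne_of_mem_erase hi)]]
    rw [map_sub, Finsupp.add_apply]
    push_cast
    ring

theorem erase (h : IsPresentation μ s w v) (ha : a ∈ s) (hb : b ∈ s) (hab : a ≠ b)
    (hw : w a = w b) : IsPresentation μ (s.erase b) w (Function.update v a (v a + v b)) where
  ne_zero i hi := h.ne_zero i (Finset.mem_of_mem_erase hi)
  span_eq := by
    rw [eq_top_iff, ← h.span_eq, Submodule.span_le]
    rintro _ ⟨i, hi, rfl⟩
    apply Submodule.subset_span
    rcases eq_or_ne i b with rfl | hne
    · exact ⟨a, Finset.mem_coe.2 (Finset.mem_erase.2 ⟨hab, ha⟩), hw⟩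
    · exact ⟨i, Finset.mem_coe.2 (Finset.mem_erase.2 ⟨hne, hi⟩), rfl⟩
  map_eq φ j := by
    rw [h.map_eq, Finset.sum_eq_add_add_sum_erase_erase ha hb hab,
      ← Finset.add_sum_erase _ _ (Finset.mem_erase.2 ⟨hab, ha⟩), Function.update_self,
      Finset.erase_right_comm]
    rw [Finset.sum_congr rfl (g := fun i => φ (w i) * (v i j : ℤ))
      (s₁ := (s.erase b).erase a)
      (f := fun i => φ (w i) * (Function.update v a (v a + v b) i j : ℤ))
      fun i hi => by rw [Function.update_of_ne (Finset.ne_of_mem_erase hi)]]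
    rw [Finsupp.add_apply, hw]
    push_cast
    ring

end IsPresentation

theorem sum_smul_update_eq_zero [DecidableEq ι] {a b : ι} {c : ι → ℤ} (ha : a ∈ s) (hb : b ∈ s)
    (hab : a ≠ b) (hc : ∑ i ∈ s, c i • w i = 0) :
    ∑ i ∈ s, Function.update c b (c a + c b) i • Function.update w a (w a - w b) i = 0 := by
  rw [Finset.sum_eq_add_add_sum_erase_erase ha hb hab] at hc ⊢
  rw [Function.update_self, Function.update_of_ne hab, Function.update_self,
      Function.update_of_ne hab.symm]
  rw [Finset.sum_congr rfl (g := fun i => c i • w i) fun i hi => by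
      rw [Function.update_of_ne (Finset.ne_of_mem_erase (Finset.mem_of_mem_erase hi)),
        Function.update_of_ne (Finset.ne_of_mem_erase hi)]]
  rw [← hc]
  module

/-- The face of a simplicial half-open cone spanned by the generators dual to `t ⊆ s`. -/
def halfOpenFace (N : Γ → Prop) (s t : Finset ι) (w : ι → Γ) : Set (Γ →ₗ[ℤ] ℤ) :=
  {φ | φ ∈ halfOpenCone N t w ∧ ∀ i ∈ s, i ∉ t → φ (w i) = 0}

section Simplicial

variable [DecidableEq ι] {N : Γ → Prop} {a : ι} {t : Finset ι} {e : Γ →ₗ[ℤ] ℤ}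

theorem mem_halfOpenFace_insert (hts : insert a t ⊆ s) (hat : a ∉ t) (hea : e (w a) = 1)
    (he : ∀ i ∈ s, i ≠ a → e (w i) = 0) (φ : Γ →ₗ[ℤ] ℤ) (k : ℤ) :
    φ - k • e ∈ halfOpenFace N s (insert a t) w ↔
      (0 ≤ φ (w a) - k ∧ (N (w a) → 0 < φ (w a) - k)) ∧ φ ∈ halfOpenCone N t w ∧
        ∀ i ∈ s, i ∉ insert a t → φ (w i) = 0 := by
  rw [Finset.insert_subset_iff] at hts
  have h1 : (φ - k • e) (w a) = φ (w a) - k := by simp [hea]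
  have h2 : ∀ i ∈ s, i ≠ a → (φ - k • e) (w i) = φ (w i) := fun i hi hne => by
    simp [he i hi hne]
  simp only [halfOpenFace, halfOpenCone, Set.mem_ofPred_eq, Finset.forall_mem_insert, h1, and_assoc]
  refine and_congr_right fun _ => and_congr_right fun _ => and_congr ?_ ?_
  · refine forall₂_congr fun i hi => ?_
    rw [h2 i (hts.2 hi) (ne_of_mem_of_not_mem hi hat)]
  · refine forall₃_congr fun i hi hit => ?_
    rw [h2 i hi fun h => hit (h ▸ Finset.mem_insert_self _ _)]

theorem mem_halfOpenFace_sub (hts : insert a t ⊆ s) (hat : a ∉ t) (hea : e (w a) = 1)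
    (he : ∀ i ∈ s, i ≠ a → e (w i) = 0) (φ : Γ →ₗ[ℤ] ℤ) (k : ℤ) :
    φ - k • e ∈ halfOpenFace N s t w ↔
      φ (w a) = k ∧ φ ∈ halfOpenCone N t w ∧ ∀ i ∈ s, i ∉ insert a t → φ (w i) = 0 := by
  rw [Finset.insert_subset_iff] at hts
  have h1 : (φ - k • e) (w a) = φ (w a) - k := by simp [hea]
  have h2 : ∀ i ∈ s, i ≠ a → (φ - k • e) (w i) = φ (w i) := fun i hi hne => by
    simp [he i hi hne]
  have h3 : φ - k • e ∈ halfOpenCone N t w ↔ φ ∈ halfOpenCone N t w :=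
    forall₂_congr fun i hi => by rw [h2 i (hts.2 hi) (ne_of_mem_of_not_mem hi hat)]
  rw [halfOpenFace, Set.mem_ofPred_eq, h3]
  constructor
  · rintro ⟨h4, h5⟩
    refine ⟨sub_eq_zero.1 (h1 ▸ h5 a hts.1 hat), h4, fun i hi hit => ?_⟩
    rw [Finset.mem_insert, not_or] at hit
    rw [← h2 i hi hit.1]
    exact h5 i hi hit.2
  · rintro ⟨h4, h5, h6⟩
    refine ⟨h5, fun i hi hit => ?_⟩
    rcases eq_or_ne i a with rfl | hne
    · rw [h1, h4, sub_self]
    · rw [h2 i hi hne]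
      exact h6 i hi fun h => (Finset.mem_insert.1 h).elim hne hit

theorem mem_image_add_iff_sub_one_smul_mem (C : Set (Γ →ₗ[ℤ] ℤ)) (φ : Γ →ₗ[ℤ] ℤ) :
    φ ∈ (fun ψ => ψ + e) '' C ↔ φ - (1 : ℤ) • e ∈ C := by
  rw [one_smul]
  constructor
  · rintro ⟨ψ, hψ, rfl⟩
    simpa using hψ
  · exact fun h => ⟨_, h, sub_add_cancel _ _⟩

theorem IsPresentation.map_nonneg_of_mem_halfOpenFace (h : IsPresentation μ s w v)
    {φ : Γ →ₗ[ℤ] ℤ} (hφ : φ ∈ halfOpenFace N s t w) (j : Fin n) : 0 ≤ μ φ j := by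
  refine h.map_nonneg (fun i hi => ?_) j
  by_cases hit : i ∈ t
  · exact (hφ.1 i hit).1
  · exact (hφ.2 i hi hit).ge

/-- Adding a generator to a face multiplies the generating function by `1 / (1 - y^v)` on a closed
side, and by `y^v / (1 - y^v)` on an open one. -/
theorem one_sub_mul_genFun_halfOpenFace (hμ : Function.Injective μ) (h : IsPresentation μ s w v)
    (hts : insert a t ⊆ s) (hat : a ∉ t) (hea : e (w a) = 1)
    (he : ∀ i ∈ s, i ≠ a → e (w i) = 0) :
    (¬ N (w a) →
      ((1 - MvPolynomial.monomial (v a) 1 : MvPolynomial (Fin n) ℂ) : MvPowerSeries (Fin n) ℂ) *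
        genFun μ (halfOpenFace N s (insert a t) w) = genFun μ (halfOpenFace N s t w)) ∧
    (N (w a) →
      ((1 - MvPolynomial.monomial (v a) 1 : MvPolynomial (Fin n) ℂ) : MvPowerSeries (Fin n) ℂ) *
        genFun μ (halfOpenFace N s (insert a t) w) =
      ((MvPolynomial.monomial (v a) 1 : MvPolynomial (Fin n) ℂ) : MvPowerSeries (Fin n) ℂ) *
        genFun μ (halfOpenFace N s t w)) := by
  have hv := h.map_dual (Finset.insert_subset_iff.1 hts).1 hea he
  have hcoe : ((1 - MvPolynomial.monomial (v a) 1 : MvPolynomial (Fin n) ℂ) :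
      MvPowerSeries (Fin n) ℂ) =
      1 - ((MvPolynomial.monomial (v a) 1 : MvPolynomial (Fin n) ℂ) :
        MvPowerSeries (Fin n) ℂ) := by
    rw [eq_sub_iff_add_eq, ← MvPolynomial.coe_add, sub_add_cancel, MvPolynomial.coe_one]
  have h0 := fun φ => mem_halfOpenFace_insert (N := N) hts hat hea he φ 0
  have h1 := fun φ => mem_halfOpenFace_insert (N := N) hts hat hea he φ 1
  have h2 := fun φ => mem_halfOpenFace_sub (N := N) hts hat hea he φ 0
  have h3 := fun φ => mem_halfOpenFace_sub (N := N) hts hat hea he φ 1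
  simp only [zero_smul, sub_zero, ← mem_image_add_iff_sub_one_smul_mem] at h0 h1 h2 h3
  refine ⟨fun hN => ?_, fun hN => ?_⟩
  · rw [hcoe, sub_mul, one_mul, sub_eq_iff_eq_add, ← genFun_translate
      (fun φ hφ => h.map_nonneg_of_mem_halfOpenFace hφ) hv, ← genFun_union hμ]
    · congr 1
      ext φ
      rw [Set.mem_union, h0, h1, h2]
      have : 0 ≤ φ (w a) ↔ φ (w a) = 0 ∨ 0 ≤ φ (w a) - 1 := by omega
      tauto
    · refine Set.disjoint_left.2 fun φ hφ hφ' => ?_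
      have := ((h2 φ).1 hφ).1
      have := ((h1 φ).1 hφ').1.1
      omega
  · rw [hcoe, sub_mul, one_mul, sub_eq_iff_eq_add, ← genFun_translate
      (fun φ hφ => h.map_nonneg_of_mem_halfOpenFace hφ) hv, ← genFun_translate
      (fun φ hφ => h.map_nonneg_of_mem_halfOpenFace hφ) hv, ← genFun_union hμ]
    · congr 1
      ext φ
      rw [Set.mem_union, h0, h1, h3]
      have : 0 ≤ φ (w a) ∧ 0 < φ (w a) ↔
          φ (w a) = 1 ∨ 0 ≤ φ (w a) - 1 ∧ 0 < φ (w a) - 1 := by omega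
      tauto
    · refine Set.disjoint_left.2 fun φ hφ hφ' => ?_
      have := ((h3 φ).1 hφ).1
      have := ((h1 φ).1 hφ').1.2 hN
      omega

/-- Reciprocity for a unimodular simplicial cone, whose generating function is a product of
geometric series. -/
theorem reciprocal_of_linearIndepOn (hμ : Function.Injective μ) (hN : IsStrictHalf N)
    (h : IsPresentation μ s w v) (hli : LinearIndepOn ℤ w s) :
    Reciprocal (genFun μ (halfOpenCone N s w)) (genFun μ (halfOpenCone (fun a => N (-a)) s w))
      (Module.finrank ℤ (Γ →ₗ[ℤ] ℤ)) := by
  let B : Module.Basis s ℤ Γ := Module.Basis.mk (v := fun i : s => w i) hli (by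
    rw [top_le_iff, ← h.span_eq, Set.image_eq_range]
    rfl)
  have hB : ∀ i : s, B i = w i := fun i => Module.Basis.mk_apply _ _ i
  have hd : Module.finrank ℤ (Γ →ₗ[ℤ] ℤ) = s.card := by
    rw [Module.finrank_eq_card_basis B.dualBasis, Fintype.card_coe]
  have hex : ∀ a ∈ s, ∃ e : Γ →ₗ[ℤ] ℤ, e (w a) = 1 ∧ ∀ i ∈ s, i ≠ a → e (w i) = 0 := by
    intro a ha
    refine ⟨B.coord ⟨a, ha⟩, ?_, fun i hi hne => ?_⟩
    · rw [← hB ⟨a, ha⟩, B.coord_apply, B.repr_self, Finsupp.single_eq_same]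
    · rw [← hB ⟨i, hi⟩, B.coord_apply, B.repr_self, Finsupp.single_eq_of_ne]
      exact fun h => hne (congrArg Subtype.val h).symm
  have key : ∀ t ⊆ s, Reciprocal (genFun μ (halfOpenFace N s t w))
      (genFun μ (halfOpenFace (fun a => N (-a)) s t w)) t.card := by
    intro t
    induction t using Finset.induction_on with
    | empty =>
      intro _
      have hempty : ∀ M : Γ → Prop, halfOpenFace M s ∅ w = {0} := by
        intro M
        ext φ
        rw [Set.mem_singleton_iff]
        constructor
        · rintro ⟨-, hφ⟩
          refine B.ext fun i => ?_
          rw [hB, LinearMap.zero_apply]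
          exact hφ i i.2 (Finset.notMem_empty _)
        · rintro rfl
          exact ⟨fun i hi => absurd hi (Finset.notMem_empty _), fun _ _ _ => rfl⟩
      rw [hempty, hempty, genFun_singleton_zero, Finset.card_empty]
      exact .one
    | insert a t hat ih =>
      intro hts
      have ha := (Finset.insert_subset_iff.1 hts).1
      obtain ⟨e, hea, he⟩ := hex a ha
      have hv : v a ≠ 0 := by
        intro hv
        have : e = 0 := hμ <| funext fun j => by
          rw [h.map_dual ha hea he, hv, map_zero]
          rfl
        rw [this] at hea
        exact zero_ne_one hea
      have h1 := one_sub_mul_genFun_halfOpenFace (N := N) hμ h hts hat hea he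
      have h2 := one_sub_mul_genFun_halfOpenFace (N := fun a => N (-a)) hμ h hts hat hea he
      have ih := ih (Finset.insert_subset_iff.1 hts).2
      rw [Finset.card_insert_of_notMem hat]
      by_cases hNa : N (w a)
      · exact ih.of_one_sub_mul_right hv (h1.2 hNa) (h2.1 (hN.not_neg hNa))
      · exact ih.of_one_sub_mul_left hv (h1.1 hNa)
          (h2.2 ((hN.total (h.ne_zero a ha)).resolve_left hNa))
  have hface : ∀ M : Γ → Prop, halfOpenFace M s s w = halfOpenCone M s w := fun M =>
    Set.ext fun φ => and_iff_left fun i hi hi' => absurd hi hi'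
  rw [hd, ← hface, ← hface]
  exact key s subset_rfl

end Simplicial

end Presentations

/-! ### Elliott's algorithm -/

section Elliott

variable {Γ : Type*} [AddCommGroup Γ] {ι : Type*} {n : ℕ}
  {μ : (Γ →ₗ[ℤ] ℤ) →+ (Fin n → ℤ)} {s : Finset ι} {w : ι → Γ} {v : ι → Fin n →₀ ℕ} {N : Γ → Prop}

theorem reciprocal_of_nonneg_relation (hN : IsStrictHalf N) (h : IsPresentation μ s w v)
    {c : ι → ℤ} (hc : ∑ i ∈ s, c i • w i = 0) (hpos : ∀ i ∈ s, 0 ≤ c i)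
    (hne : ∃ i ∈ s, c i ≠ 0) (d : ℕ) :
    Reciprocal (genFun μ (halfOpenCone N s w)) (genFun μ (halfOpenCone (fun a => N (-a)) s w))
      d := by
  rw [halfOpenCone_eq_empty hN h.ne_zero hc hpos hne,
    halfOpenCone_eq_empty hN.neg h.ne_zero hc hpos hne, genFun_empty]
  exact .zero

variable [DecidableEq ι]

/-- The number of coefficients of a relation equal to one of the two bounds `-Q` and `P`. -/
def extremeCount (s : Finset ι) (c : ι → ℤ) (P Q : ℕ) : ℕ :=
  (s.filter fun i => c i = P ∨ c i = -Q).card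

theorem extremeCount_update_lt {c : ι → ℤ} {P Q : ℕ} {b : ι} (hb : b ∈ s)
    (hcb : c b = P ∨ c b = -Q) {x : ℤ} (hP : x < P) (hQ : -Q < x) :
    extremeCount s (Function.update c b x) P Q < extremeCount s c P Q := by
  refine Finset.card_lt_card (Finset.ssubset_iff_of_subset ?_ |>.2
    ⟨b, Finset.mem_filter.2 ⟨hb, hcb⟩, ?_⟩)
  · intro i hi
    obtain ⟨his, hi⟩ := Finset.mem_filter.1 hi
    refine Finset.mem_filter.2 ⟨his, ?_⟩
    rcases eq_or_ne i b with rfl | hne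
    · exact hcb
    · rwa [Function.update_of_ne hne] at hi
  · rw [Finset.mem_filter, Function.update_self]
    omega

/-- Reciprocity for all presentations with a given nontrivial relation, by Elliott's algorithm:
cutting along `w a = w b`, where `c a = P` and `c b = -Q` are extreme coefficients of the relation,
replaces one of them by `P - Q`, which is not extreme. When a bound is no longer attained, it can be
lowered; the weight `s.card + 1` makes this outweigh the growth of the number of extreme
coefficients. -/
theorem reciprocal_of_relation (hμ : Function.Injective μ) (hN : IsStrictHalf N)
    (ih : ∀ (t : Finset ι) (w : ι → Γ) (v : ι → Fin n →₀ ℕ), t.card < s.card →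
      IsPresentation μ t w v → Reciprocal (genFun μ (halfOpenCone N t w))
        (genFun μ (halfOpenCone (fun a => N (-a)) t w)) (Module.finrank ℤ (Γ →ₗ[ℤ] ℤ)))
    (k P Q : ℕ) (c : ι → ℤ) (w : ι → Γ) (v : ι → Fin n →₀ ℕ)
    (hk : (P + Q) * (s.card + 1) + extremeCount s c P Q ≤ k) (h : IsPresentation μ s w v)
    (hc : ∑ i ∈ s, c i • w i = 0) (hne : ∃ i ∈ s, c i ≠ 0) (hP : ∀ i ∈ s, c i ≤ P)
    (hQ : ∀ i ∈ s, -Q ≤ c i) :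
    Reciprocal (genFun μ (halfOpenCone N s w)) (genFun μ (halfOpenCone (fun a => N (-a)) s w))
      (Module.finrank ℤ (Γ →ₗ[ℤ] ℤ)) := by
  induction k generalizing P Q c w v with
  | zero =>
    have hP0 : P = 0 := by
      by_contra hP0
      have : 0 < (P + Q) * (s.card + 1) := by positivity
      omega
    have hQ0 : Q = 0 := by
      by_contra hQ0
      have : 0 < (P + Q) * (s.card + 1) := by positivity
      omega
    obtain ⟨i, hi, hci⟩ := hne
    have := hP i hi
    have := hQ i hi
    omega
  | succ k ihk =>
    have hle : ∀ P Q, extremeCount s c P Q ≤ s.card := fun P Q => Finset.card_filter_le _ _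
    by_cases hQ0 : Q = 0
    · subst hQ0
      exact reciprocal_of_nonneg_relation hN h hc (by simpa using hQ) hne _
    by_cases hP0 : P = 0
    · subst hP0
      refine reciprocal_of_nonneg_relation hN h (c := -c) ?_ (by simpa using hP)
        (by simpa using hne) _
      simpa using hc
    by_cases hPa : ∃ a ∈ s, c a = P
    swap
    · push Not at hPa
      obtain ⟨P, rfl⟩ := Nat.exists_eq_succ_of_ne_zero hP0
      refine ihk P Q c w v ?_ h hc hne (fun i hi => ?_) hQ
      · have := hle P Q
        rw [show P.succ + Q = P + Q + 1 by omega, add_mul, one_mul] at hk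
        omega
      · have := hP i hi
        have := hPa i hi
        push_cast at *
        omega
    by_cases hQb : ∃ b ∈ s, c b = -Q
    swap
    · push Not at hQb
      obtain ⟨Q, rfl⟩ := Nat.exists_eq_succ_of_ne_zero hQ0
      refine ihk P Q c w v ?_ h hc hne hP (fun i hi => ?_)
      · have := hle P Q
        rw [show P + Q.succ = P + Q + 1 by omega, add_mul, one_mul] at hk
        omega
      · have := hQ i hi
        have := hQb i hi
        push_cast at *
        omega
    obtain ⟨a, ha, hca⟩ := hPa
    obtain ⟨b, hb, hcb⟩ := hQb
    have hab : a ≠ b := by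
      rintro rfl
      omega
    by_cases hw : w a = w b
    · rw [← halfOpenCone_erase ha hb hab hw, ← halfOpenCone_erase ha hb hab hw]
      exact ih _ _ _ (Finset.card_erase_lt_of_mem hb) (h.erase ha hb hab hw)
    rw [halfOpenCone_eq_union hN h.ne_zero ha hb hab hw,
      halfOpenCone_eq_union hN.neg h.ne_zero ha hb hab hw,
      genFun_union hμ (disjoint_halfOpenCone_update hN ha hb hw),
      genFun_union hμ (disjoint_halfOpenCone_update hN.neg ha hb hw)]
    have hbound : ∀ (e : ι) (x : ℤ), -Q ≤ x → x ≤ P →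
        (∀ i ∈ s, Function.update c e x i ≤ P) ∧ ∀ i ∈ s, -Q ≤ Function.update c e x i := by
      intro e x h1 h2
      refine ⟨fun i hi => ?_, fun i hi => ?_⟩ <;> rw [Function.update_apply] <;> split_ifs
      exacts [h2, hP i hi, h1, hQ i hi]
    refine .add ?_ ?_
    · have hlt := extremeCount_update_lt (s := s) hb (Or.inr hcb) (x := c a + c b) (P := P) (Q := Q)
        (by omega) (by omega)
      have hbd := hbound b (c a + c b) (by omega) (by omega)
      refine ihk P Q (Function.update c b (c a + c b)) _ _ (by omega) (h.shear ha hb hab hw)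
        (sum_smul_update_eq_zero ha hb hab hc) ⟨a, ha, ?_⟩ hbd.1 hbd.2
      rw [Function.update_of_ne hab]
      omega
    · have hlt := extremeCount_update_lt (s := s) ha (Or.inl hca) (x := c b + c a) (P := P) (Q := Q)
        (by omega) (by omega)
      have hbd := hbound a (c b + c a) (by omega) (by omega)
      refine ihk P Q (Function.update c a (c b + c a)) _ _ (by omega)
        (h.shear hb ha hab.symm (Ne.symm hw)) (sum_smul_update_eq_zero hb ha hab.symm hc)
        ⟨b, hb, ?_⟩ hbd.1 hbd.2
      rw [Function.update_of_ne hab.symm]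
      omega

/-- Reciprocity for half-open cones: the cone in which the facets with `w i ∈ N` are open is
exchanged with the one in which the other facets are open. -/
theorem reciprocal_halfOpenCone (hμ : Function.Injective μ) (hN : IsStrictHalf N)
    (h : IsPresentation μ s w v) :
    Reciprocal (genFun μ (halfOpenCone N s w)) (genFun μ (halfOpenCone (fun a => N (-a)) s w))
      (Module.finrank ℤ (Γ →ₗ[ℤ] ℤ)) := by
  induction hs : s.card using Nat.strong_induction_on generalizing s w v with
  | _ k ih =>
    subst hs
    by_cases hli : LinearIndepOn ℤ w s
    · exact reciprocal_of_linearIndepOn hμ hN h hli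
    rw [linearIndepOn_finset_iff] at hli
    push Not at hli
    obtain ⟨c, hc, hne⟩ := hli
    have hbd : ∀ i ∈ s, |c i| ≤ ((∑ i ∈ s, (c i).natAbs : ℕ) : ℤ) := fun i hi => by
      rw [Int.abs_eq_natAbs]
      exact_mod_cast Finset.single_le_sum (f := fun i => (c i).natAbs) (fun _ _ => Nat.zero_le _) hi
    exact reciprocal_of_relation hμ hN (fun t w v ht h' => ih _ ht h' rfl) _ _ _ c w v le_rfl h hc
      hne (fun i hi => (abs_le.1 (hbd i hi)).2) (fun i hi => (abs_le.1 (hbd i hi)).1)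

end Elliott

/-! ### Solutions of linear homogeneous Diophantine systems -/

section Kernel

variable {n m : ℕ}

/-- The `i`-th coordinates of the vectors `u 0, …, u m`, as an element of `ℤ^(m+1)` ordered
lexicographically. -/
def lexCoord (u : Fin (m + 1) → Fin n → ℤ) (i : Fin n) : Lex (Fin (m + 1) → ℤ) :=
  toLex fun j => u j i

/-- The group generated by the coordinates of the vectors `u 0, …, u m`: the dual of the lattice
generated by these vectors, with a total order that refines evaluation at `u 0`. -/
abbrev CoordGroup (u : Fin (m + 1) → Fin n → ℤ) : Type :=
  Submodule.span ℤ (Set.range (lexCoord u))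

/-- `lexCoord u i` as an element of `CoordGroup u`. -/
def coordVec (u : Fin (m + 1) → Fin n → ℤ) (i : Fin n) : CoordGroup u :=
  ⟨lexCoord u i, Submodule.subset_span ⟨i, rfl⟩⟩

/-- The vector of values of a functional on `CoordGroup u` at the coordinates. When `u 0, …, u m`
generate the kernel of an integer matrix, this identifies the functionals with that kernel
(`evalCoords_injective`, `range_evalCoords`). -/
def evalCoords (u : Fin (m + 1) → Fin n → ℤ) : (CoordGroup u →ₗ[ℤ] ℤ) →ₗ[ℤ] (Fin n → ℤ) where
  toFun φ i := φ (coordVec u i)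
  map_add' _ _ := rfl
  map_smul' _ _ := rfl

/-- The functional on `CoordGroup u` that corresponds to the vector `u j`. -/
def coordEval (u : Fin (m + 1) → Fin n → ℤ) (j : Fin (m + 1)) : CoordGroup u →ₗ[ℤ] ℤ where
  toFun γ := ofLex γ.1 j
  map_add' _ _ := rfl
  map_smul' _ _ := rfl

variable {u : Fin (m + 1) → Fin n → ℤ}

theorem span_range_coordVec : Submodule.span ℤ (Set.range (coordVec u)) = ⊤ :=
  Submodule.map_injective_of_injective (Submodule.subtype_injective _) (by
    rw [Submodule.map_span, Submodule.map_top, Submodule.range_subtype, ← Set.range_comp]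
    rfl)

theorem evalCoords_injective : Function.Injective (evalCoords u) := by
  intro φ ψ h
  refine LinearMap.ext_on_range span_range_coordVec fun i => ?_
  exact congrFun h i

theorem range_evalCoords {r : ℕ} {A : Matrix (Fin r) (Fin n) ℤ}
    (hu : Submodule.span ℤ (Set.range u) = LinearMap.ker A.mulVecLin) :
    LinearMap.range (evalCoords u) = LinearMap.ker A.mulVecLin := by
  refine le_antisymm ?_ ?_
  · rintro _ ⟨φ, rfl⟩
    rw [LinearMap.mem_ker]
    ext k
    have h1 : ∑ i, A k i • coordVec u i = 0 := by
      refine Subtype.ext (ofLex.injective (funext fun j => ?_))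
      change coordEval u j (∑ i, A k i • coordVec u i) = 0
      have h2 : A.mulVecLin (u j) = 0 :=
        LinearMap.mem_ker.1 (hu ▸ Submodule.subset_span ⟨j, rfl⟩)
      rw [map_sum]
      exact (Finset.sum_congr rfl fun i _ => map_smul _ _ _).trans (congrFun h2 k)
    have h2 := congrArg φ h1
    rw [map_sum, map_zero] at h2
    simpa [Matrix.mulVec, dotProduct, evalCoords] using h2
  · rw [← hu, Submodule.span_le]
    rintro _ ⟨j, rfl⟩
    exact ⟨coordEval u j, rfl⟩

theorem finrank_dual_coordGroup {r : ℕ} {A : Matrix (Fin r) (Fin n) ℤ}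
    (hu : Submodule.span ℤ (Set.range u) = LinearMap.ker A.mulVecLin) (hA : A.rank = r) :
    Module.finrank ℤ (CoordGroup u →ₗ[ℤ] ℤ) = n - r := by
  have h1 := LinearMap.finrank_range_of_inj (f := evalCoords u) evalCoords_injective
  rw [range_evalCoords hu] at h1
  have h2 := (LinearMap.ker A.mulVecLin).finrank_quotient_add_finrank
  rw [A.mulVecLin.quotKerEquivRange.finrank_eq] at h2
  rw [Module.finrank_fin_fun] at h2
  have h3 : Module.finrank ℤ (LinearMap.range A.mulVecLin) = r := hA
  omega

theorem isStrictHalf_neg : IsStrictHalf fun γ : CoordGroup u => γ.1 < 0 where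
  add ha hb := add_neg ha hb
  not_neg ha hb := by
    have : -_ < (0 : Lex (Fin (m + 1) → ℤ)) := hb
    exact lt_asymm ha (neg_lt_zero.1 this)
  total {a} ha := by
    rcases lt_trichotomy a.1 0 with h | h | h
    · exact Or.inl h
    · exact absurd (Subtype.ext h) ha
    · exact Or.inr (neg_lt_zero.2 h)

theorem coordVec_pos (hu : ∀ i, 0 < u 0 i) (i : Fin n) : 0 < (coordVec u i).1 :=
  ⟨0, fun j hj => absurd hj (Fin.not_lt_zero j), hu i⟩

theorem isPresentation_coordVec (hu : ∀ i, 0 < u 0 i) :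
    IsPresentation (evalCoords u).toAddMonoidHom Finset.univ (coordVec u)
      (fun i => Finsupp.single i 1) where
  ne_zero i _ h := (coordVec_pos hu i).ne' (congrArg Subtype.val h)
  span_eq := by rw [Finset.coe_univ, Set.image_univ, span_range_coordVec]
  map_eq φ j := by
    simp [Finsupp.single_apply, evalCoords]

end Kernel

theorem mem_polyhedron_zero_iff {r n : ℕ} (A : Matrix (Fin r) (Fin n) ℤ) (m : Fin n →₀ ℕ) :
    (fun i => (m i : ℝ)) ∈ polyhedron A 0 ↔
      (fun i => (m i : ℤ)) ∈ LinearMap.ker A.mulVecLin := by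
  rw [LinearMap.mem_ker, polyhedron, Set.mem_ofPred_eq, and_iff_right fun i => Nat.cast_nonneg _,
    funext_iff, funext_iff]
  refine forall_congr' fun k => ?_
  simp only [Matrix.mulVec, dotProduct, Matrix.map_apply, Pi.zero_apply, Int.cast_zero,
    Matrix.mulVecLin_apply]
  exact_mod_cast Iff.rfl

theorem latticeGenFun_eq_genFun {n : ℕ} {Λ : Type*} [AddCommGroup Λ] {μ : Λ →+ (Fin n → ℤ)}
    {S : Set (Fin n → ℝ)} {C : Set Λ}
    (h : ∀ m : Fin n →₀ ℕ, (fun i => (m i : ℝ)) ∈ S ↔ ∃ φ ∈ C, ∀ j, μ φ j = m j) :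
    latticeGenFun S = genFun μ C := by
  funext m
  by_cases hm : (fun i => (m i : ℝ)) ∈ S
  · rw [latticeGenFun, genFun, if_pos hm, if_pos ((h m).1 hm)]
  · rw [latticeGenFun, genFun, if_neg hm, if_neg fun h' => hm ((h m).2 h')]

theorem corollary4p6 (r n : ℕ) (A : Matrix (Fin r) (Fin n) ℤ) (hrank : A.rank = r)
    (hpos : ∃ α : Fin n → ℤ, (∀ i, 0 < α i) ∧ A.mulVec α = 0) :
    ∃ R Rbar : RatFunField n,
      IsExpansionOf (latticeGenFun (polyhedron A 0)) R ∧
      IsExpansionOf (latticeGenFun (polyhedron A 0 ∩ positivePoints n)) Rbar ∧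
      R = (-1) ^ (n - r) * invVars n Rbar := by
  obtain ⟨α, hα, hAα⟩ := hpos
  obtain ⟨m, u', hu'⟩ := Submodule.fg_iff_exists_fin_generating_family.1
    (IsNoetherian.noetherian (LinearMap.ker A.mulVecLin))
  let u : Fin (m + 1) → Fin n → ℤ := Fin.cons α u'
  have hu : Submodule.span ℤ (Set.range u) = LinearMap.ker A.mulVecLin := by
    rw [Fin.range_cons, Submodule.span_insert, hu', sup_eq_right,
      Submodule.span_singleton_le_iff_mem]
    exact hAα
  have hu0 : ∀ i, 0 < u 0 i := hα
  have key := reciprocal_halfOpenCone evalCoords_injective isStrictHalf_neg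
    (isPresentation_coordVec hu0)
  rw [finrank_dual_coordGroup hu hrank] at key
  have hker : ∀ m : Fin n →₀ ℕ, (fun i => (m i : ℝ)) ∈ polyhedron A 0 ↔
      ∃ φ, ∀ j, evalCoords u φ j = m j := fun m => by
    rw [mem_polyhedron_zero_iff, ← range_evalCoords hu]
    exact exists_congr fun φ => funext_iff
  have hval : ∀ φ j, evalCoords u φ j = φ (coordVec u j) := fun _ _ => rfl
  have h1 : latticeGenFun (polyhedron A 0) = genFun (evalCoords u).toAddMonoidHom
      (halfOpenCone (fun γ => γ.1 < 0) Finset.univ (coordVec u)) := by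
    refine latticeGenFun_eq_genFun fun m => (hker m).trans (exists_congr fun φ => ?_)
    refine (and_iff_right_of_imp fun h i _ => ⟨?_, fun h' => ?_⟩).symm
    · rw [← hval, h]
      positivity
    · exact absurd h' (coordVec_pos hu0 i).asymm
  have h2 : latticeGenFun (polyhedron A 0 ∩ positivePoints n) =
      genFun (evalCoords u).toAddMonoidHom
        (halfOpenCone (fun γ => (-γ).1 < 0) Finset.univ (coordVec u)) := by
    refine latticeGenFun_eq_genFun fun m => ?_
    have hpos : (fun i => (m i : ℝ)) ∈ positivePoints n ↔ ∀ i, 0 < m i := by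
      refine forall_congr' fun i => ⟨?_, fun h => ⟨m i, h, rfl⟩⟩
      rintro ⟨k, hk, e⟩
      rwa [Nat.cast_injective e]
    rw [Set.mem_inter_iff, hker, hpos]
    constructor
    · rintro ⟨⟨φ, hφ⟩, h⟩
      refine ⟨φ, fun i _ => ?_, hφ⟩
      rw [← hval, hφ]
      have := h i
      omega
    · rintro ⟨φ, hφ, e⟩
      refine ⟨⟨φ, e⟩, fun i => ?_⟩
      have h3 := (hφ i (Finset.mem_univ i)).2 (neg_lt_zero.2 (coordVec_pos hu0 i))
      have h4 : φ (coordVec u i) = m i := e i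
      omega
  rw [h1, h2]
  exact key
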